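/- Let $(\Omega,\mathcal F,\mathbb P)$ be a probability space, let $L^0$ be the space of (a.s. equivalence classes of) real random variables on it, and let $l:\mathbb R\to\mathbb R$ be a nondecreasing convex function with $l(0)>\inf_{x}l(x)$. Define the utility-based shortfall risk function on $L^\infty$ by $$\varphi_l(X)=\inf\{x\in\mathbb R:\ \mathbb E[l(X-x)]\le l(0)\},\qquad X\in L^\infty,$$ its conjugate by $\varphi_l^*(Z)=\sup_{X\in L^\infty}(\mathbb E[XZ]-\varphi_l(X))$ for $Z\in L^1$, and $$\hat\varphi_l(X)=\sup\{\mathbb E[XZ]-\varphi_l^*(Z):\ Z\in L^1,\ \varphi_l^*(Z)<\infty\},$$ which is well defined with values in $(-\infty,\infty]$ for every $X\in L^0$ with $X\ge 0$. Put $$M^{\hat\varphi_l}=\{X\in L^0:\ \hat\varphi_l(\alpha|X|)<\infty\ \ \forall\alpha>0\},$$ $$M^{\hat\varphi_l}_u=\Big\{X\in L^0:\ \lim_{N\to\infty}\hat\varphi_l\big(\alpha|X|\mathbf 1_{\{|X|>N\}}\big)=0\ \ \forall\alpha>0\Big\}.$$ Let $\Phi_l(x)=l(|x|)-l(0)$ for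 $x\in\mathbb R$ and let $M^{\Phi_l}=\{X\in L^0:\ \mathbb E[\Phi_l(\alpha|X|)]<\infty\ \ \forall\alpha>0\}$. Then $\Phi_l$ is a finite Young function (a lower semicontinuous even convex function $\mathbb R\to[0,\infty)$ with $\Phi_l(0)=0$ and $\Phi_l(x)\to\infty$ as $x\to\infty$), so that $M^{\Phi_l}$ is its Orlicz heart, and $$M^{\hat\varphi_l}_u=M^{\hat\varphi_l}=M^{\Phi_l}.$$ -/

import Mathlib

open MeasureTheory Filter Topology
open scoped ENNReal

noncomputable section

namespace ShortfallRisk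

/-- The extended expectation `E[Y] = E[Y⁺] - E[Y⁻]`, with values in `[-∞, ∞]`. It is meaningful as
soon as one of the two terms is finite; it is used below only for such `Y`. -/
def extExp {Ω : Type*} [MeasurableSpace Ω] (P : Measure Ω) (Y : Ω → ℝ) : EReal :=
  ((∫⁻ ω, ENNReal.ofReal (Y ω) ∂P : ℝ≥0∞) : EReal)
    - ((∫⁻ ω, ENNReal.ofReal (-Y ω) ∂P : ℝ≥0∞) : EReal)

/-- The conjugate `φ₀*(Z) = sup_{X ∈ L^∞} (E[XZ] - φ₀(X))`, `Z ∈ L¹`. -/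
def conjugate {Ω : Type*} [MeasurableSpace Ω] {P : Measure Ω} (φ₀ : Lp ℝ ∞ P → EReal)
    (Z : Lp ℝ 1 P) : EReal :=
  ⨆ X : Lp ℝ ∞ P, (((∫ ω, X ω * Z ω ∂P : ℝ) : EReal) - φ₀ X)

/-- The effective domain of the conjugate, a subset of `L¹`. -/
def domConj {Ω : Type*} [MeasurableSpace Ω] {P : Measure Ω} (φ₀ : Lp ℝ ∞ P → EReal) :
    Set (Lp ℝ 1 P) :=
  {Z | conjugate φ₀ Z < ⊤}

/-- The extension `φ̂(X) = sup_{Z ∈ dom φ₀*} (E[XZ] - φ₀*(Z))`. It is meaningful for those random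
variables `X` such that `X⁻ Z ∈ L¹` for all `Z ∈ dom φ₀*`, in particular (for monotone `φ₀`) for
all `X ≥ 0`, which are the only ones it is applied to below. The value depends on the
almost sure equivalence class of `X` only. -/
def phiHat {Ω : Type*} [MeasurableSpace Ω] {P : Measure Ω} (φ₀ : Lp ℝ ∞ P → EReal)
    (X : Ω → ℝ) : EReal :=
  ⨆ Z ∈ domConj φ₀, (extExp P (fun ω => X ω * Z ω) - conjugate φ₀ Z)

/-- The Orlicz heart of `φ̂`: all `X ∈ L⁰` with `φ̂(α|X|) < ∞` for every `α > 0`. -/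
def heart {Ω : Type*} [MeasurableSpace Ω] {P : Measure Ω} (φ₀ : Lp ℝ ∞ P → EReal) :
    Set (Ω →ₘ[P] ℝ) :=
  {X | ∀ α : ℝ, 0 < α → phiHat φ₀ (fun ω => α * |X ω|) < ⊤}

/-- The space `M_u` of `φ̂`: all `X ∈ L⁰` such that, for every `α > 0`,
`φ̂(α|X| 1_{|X| > N}) → 0` as `N → ∞`. -/
def heartU {Ω : Type*} [MeasurableSpace Ω] {P : Measure Ω} (φ₀ : Lp ℝ ∞ P → EReal) :
    Set (Ω →ₘ[P] ℝ) :=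
  {X | ∀ α : ℝ, 0 < α →
    Tendsto
      (fun N : ℕ => phiHat φ₀ ({ω | (N : ℝ) < |X ω|}.indicator (fun ω => α * |X ω|)))
      atTop (𝓝 0)}

/-- A finite Young function: a lower semicontinuous even convex function `Φ : ℝ → [0, ∞)` with
`Φ(0) = 0` and `Φ(x) → ∞` as `x → ∞`. -/
structure IsYoungFunction (Φ : ℝ → ℝ) : Prop where
  nonneg : ∀ x, 0 ≤ Φ x
  lsc : LowerSemicontinuous Φ
  even : ∀ x, Φ (-x) = Φ x
  convex : ConvexOn ℝ Set.univ Φ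
  zero : Φ 0 = 0
  tendsto_atTop : Tendsto Φ atTop atTop

/-- The Orlicz heart of a (nonnegative) Young function: all `X ∈ L⁰` with `E[Φ(α|X|)] < ∞` for
every `α > 0`. -/
def orliczHeart {Ω : Type*} [MeasurableSpace Ω] (P : Measure Ω) (Φ : ℝ → ℝ) :
    Set (Ω →ₘ[P] ℝ) :=
  {X | ∀ α : ℝ, 0 < α → ∫⁻ ω, ENNReal.ofReal (Φ (α * |X ω|)) ∂P < ⊤}

/-- The utility-based shortfall risk function `φ_l(X) = inf {x ∈ ℝ : E[l(X - x)] ≤ l(0)}` on `L^∞`,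
the infimum being taken in `[-∞, ∞]`. -/
def shortfall {Ω : Type*} [MeasurableSpace Ω] (P : Measure Ω) (l : ℝ → ℝ) (X : Lp ℝ ∞ P) :
    EReal :=
  ⨅ (x : ℝ) (_ : ∫ ω, l (X ω - x) ∂P ≤ l 0), (x : EReal)

/-- The function `Φ_l(x) = l(|x|) - l(0)`. -/
def youngOf (l : ℝ → ℝ) (x : ℝ) : ℝ := l |x| - l 0

end ShortfallRisk

end

/-! The extension φ̂ is defined by duality, but on nonnegative `Y` it is still controlled by the
acceptance condition E[l(Y - x)] ≤ l(0). From above, `phiHat_le`: truncations of `Y` are bounded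
positions, so Fenchel's inequality applies to them and Fatou passes to the limit. From below,
`exists_le_phiHat`: each truncation has an optimal dual density built from a subgradient of `l`, and
that density also tests `Y`. The equalities follow from a cycle of inclusions. Dual densities are
nonnegative with mass at most one, so adding a bounded part keeps φ̂ finite (`heartU_subset_heart`).
If φ̂(2α|X|) is finite, then l(2α|X| - c) has finite expectation for some `c`, and convexity removes
the shift (`heart_subset_orliczHeart`). If all l(α|X|) are integrable, dominated convergence gives
E[l(Y_N - ε)] → l(-ε) < l(0) for the tails `Y_N` of α|X|, whence φ̂(Y_N) ≤ ε eventually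
(`orliczHeart_subset_heartU`). -/

namespace ShortfallRisk

/-! ### Convex functions on the line -/

section ConvexReal

variable {l : ℝ → ℝ}

lemma lt_apply_zero_of_neg (hmono : Monotone l) (hconv : ConvexOn ℝ Set.univ l)
    (hinf : ∃ x, l x < l 0) {y : ℝ} (hy : y < 0) : l y < l 0 := by
  obtain ⟨x, hx⟩ := hinf
  rcases le_or_gt y x with h | h
  · exact (hmono h).trans_lt hx
  · have hx0 : x < 0 := h.trans hy
    have h1 := hconv.2 (Set.mem_univ x) (Set.mem_univ 0)
      (show 0 ≤ y / x from div_nonneg_of_nonpos hy.le hx0.le)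
      (show 0 ≤ 1 - y / x by rw [sub_nonneg, div_le_one_of_neg hx0]; exact h.le) (by ring)
    have hpos : 0 < y / x := div_pos_of_neg_of_neg hy hx0
    have h2 : y / x * x = y := div_mul_cancel₀ _ hx0.ne
    simp only [smul_eq_mul, mul_zero, add_zero, h2] at h1
    nlinarith

/-- At 0 the graph lies below the chord from -1 to `y`. The resulting linear growth makes the Young
function tend to infinity. -/
lemma apply_zero_add_mul_le (hconv : ConvexOn ℝ Set.univ l) {y : ℝ} (hy : 0 ≤ y) :
    l 0 + y * (l 0 - l (-1)) ≤ l y := by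
  have hp : 0 < 1 + y := by linarith
  have h1 := hconv.2 (Set.mem_univ (-1)) (Set.mem_univ y)
    (show 0 ≤ y / (1 + y) by positivity) (show 0 ≤ 1 / (1 + y) by positivity)
    (by field_simp; ring)
  have h2 : y / (1 + y) * (-1) + 1 / (1 + y) * y = 0 := by ring
  simp only [smul_eq_mul] at h1
  rw [h2, div_mul_eq_mul_div, div_mul_eq_mul_div, ← add_div, le_div_iff₀ hp] at h1
  linarith

lemma continuous_of_convexOn_univ (hconv : ConvexOn ℝ Set.univ l) : Continuous l :=
  continuousOn_univ.1 (hconv.continuousOn isOpen_univ)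

/-- The right derivative works. Its monotonicity supplies measurability, and boundedness along
bounded positions. -/
lemma exists_monotone_subgradient (hconv : ConvexOn ℝ Set.univ l) :
    ∃ g : ℝ → ℝ, Monotone g ∧ ∀ y z, l y + g y * (z - y) ≤ l z := by
  refine ⟨fun y => derivWithin l (Set.Ioi y) y, ?_, fun y z => ?_⟩
  · have := hconv.monotoneOn_rightDeriv
    rwa [interior_univ, monotoneOn_univ] at this
  · have hy : y ∈ interior (Set.univ : Set ℝ) := by simp
    rcases lt_trichotomy y z with h | rfl | h
    · have := hconv.rightDeriv_le_slope_of_mem_interior hy (Set.mem_univ z) h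
      rw [slope_def_field, le_div_iff₀ (sub_pos.2 h)] at this
      linarith
    · simp
    · have := (hconv.slope_le_leftDeriv_of_mem_interior (Set.mem_univ z) hy h).trans
        (hconv.leftDeriv_le_rightDeriv_of_mem_interior hy)
      rw [slope_def_field, div_le_iff₀ (sub_pos.2 h)] at this
      linarith

lemma isYoungFunction_youngOf (hmono : Monotone l) (hconv : ConvexOn ℝ Set.univ l)
    (hinf : ∃ x, l x < l 0) : IsYoungFunction (youngOf l) where
  nonneg x := sub_nonneg.2 (hmono (abs_nonneg x))
  lsc := (((continuous_of_convexOn_univ hconv).comp continuous_abs).sub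
    continuous_const).lowerSemicontinuous
  even x := by simp [youngOf]
  convex := by
    have h : ConvexOn ℝ Set.univ (l ∘ fun x : ℝ => |x|) := by
      refine ConvexOn.comp ?_ ?_ (hmono.monotoneOn _)
      · refine hconv.subset (Set.subset_univ _) ?_
        rw [Set.image_univ, show Set.range (fun x : ℝ => |x|) = Set.Ici 0 from ?_]
        · exact convex_Ici 0
        · ext x
          exact ⟨by rintro ⟨y, rfl⟩; exact abs_nonneg y, fun hx => ⟨x, abs_of_nonneg hx⟩⟩
      · exact convexOn_norm convex_univ
    exact h.sub (concaveOn_const _ convex_univ)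
  zero := by simp [youngOf]
  tendsto_atTop := by
    have h2 := lt_apply_zero_of_neg hmono hconv hinf (y := -1) (by norm_num)
    refine tendsto_atTop_mono' _ ?_ (tendsto_id.atTop_mul_const (sub_pos.2 h2))
    filter_upwards [eventually_ge_atTop 0] with x hx
    have := apply_zero_add_mul_le hconv hx
    simp only [youngOf, abs_of_nonneg hx, id]
    linarith

end ConvexReal

variable {Ω : Type*} [MeasurableSpace Ω] {P : Measure Ω} {l : ℝ → ℝ}

/-! ### Integrability, truncation and the conjugate -/

lemma ae_abs_le_of_memLp_top (X : Lp ℝ ∞ P) : ∃ C : ℝ, ∀ᵐ ω ∂P, |X ω| ≤ C := by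
  refine ⟨‖X‖, ?_⟩
  have h := ae_le_eLpNormEssSup (f := X) (μ := P)
  filter_upwards [h] with ω hω
  rw [Lp.norm_def, eLpNorm_exponent_top, ← Real.norm_eq_abs, ← toReal_enorm]
  refine ENNReal.toReal_mono ?_ hω
  rw [← eLpNorm_exponent_top]
  exact Lp.eLpNorm_ne_top X

lemma integrable_comp_of_monotone [IsFiniteMeasure P] {g : ℝ → ℝ} (hg : Monotone g)
    {f : Ω → ℝ} {C : ℝ} (hf : AEMeasurable f P) (hb : ∀ᵐ ω ∂P, |f ω| ≤ C) :
    Integrable (fun ω => g (f ω)) P := by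
  refine Integrable.of_bound (hg.measurable.comp_aemeasurable hf).aestronglyMeasurable
    (max |g (-C)| |g C|) ?_
  filter_upwards [hb] with ω hω
  have h := abs_le.1 hω
  have h1 := hg h.1
  have h2 := hg h.2
  rw [Real.norm_eq_abs]
  exact abs_le_max_abs_abs h1 h2

lemma integrable_comp_sub_of_monotone [IsFiniteMeasure P] {g : ℝ → ℝ} (hg : Monotone g)
    {f : Ω → ℝ} {C : ℝ} (hf : AEMeasurable f P) (hb : ∀ᵐ ω ∂P, |f ω| ≤ C) (x : ℝ) :
    Integrable (fun ω => g (f ω - x)) P := by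
  refine integrable_comp_of_monotone hg (C := C + |x|) (hf.sub_const x) ?_
  filter_upwards [hb] with ω hω
  exact (abs_sub _ _).trans (by linarith)

lemma lintegral_ofReal_le_of_tendsto {F : ℕ → Ω → ℝ} {f : Ω → ℝ} {c : ℝ}
    (hF : ∀ n, Integrable (F n) P) (hnn : ∀ n, 0 ≤ᵐ[P] F n)
    (hlim : ∀ᵐ ω ∂P, Tendsto (fun n => F n ω) atTop (𝓝 (f ω)))
    (hc : ∀ n, ∫ ω, F n ω ∂P ≤ c) :
    ∫⁻ ω, ENNReal.ofReal (f ω) ∂P ≤ ENNReal.ofReal c := by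
  calc ∫⁻ ω, ENNReal.ofReal (f ω) ∂P
      = ∫⁻ ω, liminf (fun n => ENNReal.ofReal (F n ω)) atTop ∂P := by
        refine lintegral_congr_ae ?_
        filter_upwards [hlim] with ω hω
        exact ((ENNReal.continuous_ofReal.tendsto _).comp hω).liminf_eq.symm
    _ ≤ liminf (fun n => ∫⁻ ω, ENNReal.ofReal (F n ω) ∂P) atTop :=
        lintegral_liminf_le' fun n => (hF n).aemeasurable.ennreal_ofReal
    _ ≤ ENNReal.ofReal c := by
        refine liminf_le_of_frequently_le' (Frequently.of_forall fun n => ?_)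
        rw [← ofReal_integral_eq_lintegral_ofReal (hF n) (hnn n)]
        exact ENNReal.ofReal_le_ofReal (hc n)

lemma tendsto_min_natCast (y : ℝ) : Tendsto (fun n : ℕ => min y (n : ℝ)) atTop (𝓝 y) := by
  refine tendsto_const_nhds.congr' ?_
  filter_upwards [eventually_ge_atTop ⌈y⌉₊] with n hn
  exact (min_eq_left ((Nat.le_ceil y).trans (by exact_mod_cast hn))).symm

lemma abs_min_natCast_le {y : ℝ} (hy : 0 ≤ y) (n : ℕ) : |min y (n : ℝ)| ≤ n := by
  rw [abs_of_nonneg (le_min hy n.cast_nonneg)]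
  exact min_le_right _ _

lemma integrable_min_mul {Y : Ω → ℝ} (hY : Measurable Y) (hY0 : ∀ ω, 0 ≤ Y ω) (n : ℕ)
    (Z : Lp ℝ 1 P) : Integrable (fun ω => min (Y ω) (n : ℝ) * Z ω) P :=
  (L1.integrable_coeFn Z).bdd_mul (c := n) (hY.min measurable_const).aestronglyMeasurable
    (ae_of_all _ fun ω => abs_min_natCast_le (hY0 ω) n)

lemma extExp_of_nonneg {f : Ω → ℝ} (hf : 0 ≤ᵐ[P] f) :
    extExp P f = ((∫⁻ ω, ENNReal.ofReal (f ω) ∂P : ℝ≥0∞) : EReal) := by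
  have h : ∫⁻ ω, ENNReal.ofReal (-f ω) ∂P = 0 := by
    rw [← lintegral_zero (μ := P)]
    refine lintegral_congr_ae ?_
    filter_upwards [hf] with ω hω
    exact ENNReal.ofReal_of_nonpos (neg_nonpos.2 hω)
  rw [extExp, h]
  simp

/-- Fenchel's inequality with an admissible level `x` in place of the infimum, stated for functions
rather than classes. -/
lemma le_conjugate {f : Ω → ℝ} {C x : ℝ} (hf : AEStronglyMeasurable f P)
    (hb : ∀ᵐ ω ∂P, |f ω| ≤ C) (hx : ∫ ω, l (f ω - x) ∂P ≤ l 0) (Z : Lp ℝ 1 P) :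
    ((∫ ω, f ω * Z ω ∂P - x : ℝ) : EReal) ≤ conjugate (shortfall P l) Z := by
  have hm : MemLp f ∞ P := memLp_top_of_bound hf C hb
  refine le_iSup_of_le (hm.toLp f) ?_
  rw [EReal.coe_sub]
  refine EReal.sub_le_sub (le_of_eq ?_) (iInf₂_le x ?_)
  · congr 1
    refine integral_congr_ae ?_
    filter_upwards [hm.coeFn_toLp] with ω hω
    rw [hω]
  · refine le_of_eq_of_le (integral_congr_ae ?_) hx
    filter_upwards [hm.coeFn_toLp] with ω hω
    rw [hω]

lemma conjugate_le {Z : Lp ℝ 1 P} {c : ℝ}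
    (h : ∀ (X : Lp ℝ ∞ P) (x : ℝ), ∫ ω, l (X ω - x) ∂P ≤ l 0 → ∫ ω, X ω * Z ω ∂P - x ≤ c) :
    conjugate (shortfall P l) Z ≤ c := by
  refine iSup_le fun X => EReal.sub_le_of_le_add ?_
  rw [add_comm]
  have h1 : ((∫ ω, X ω * Z ω ∂P - c : ℝ) : EReal) ≤ shortfall P l X := by
    refine le_iInf₂ fun x hx => ?_
    have := h X x hx
    exact_mod_cast (by linarith : ∫ ω, X ω * Z ω ∂P - c ≤ x)
  have h2 := add_le_add_left h1 (c : EReal)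
  rwa [← EReal.coe_add, sub_add_cancel] at h2

lemma conjugate_nonneg [IsProbabilityMeasure P] (Z : Lp ℝ 1 P) :
    0 ≤ conjugate (shortfall P l) Z := by
  have h := le_conjugate (l := l) (P := P) (f := fun _ => 0) (C := 0) (x := 0)
    aestronglyMeasurable_const (by simp) (by simp) Z
  simpa using h

lemma exists_conjugate_eq_coe [IsProbabilityMeasure P] {Z : Lp ℝ 1 P}
    (hZ : Z ∈ domConj (shortfall P l)) :
    ∃ r : ℝ, 0 ≤ r ∧ conjugate (shortfall P l) Z = r := by
  have h0 := conjugate_nonneg (l := l) Z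
  have h1 : conjugate (shortfall P l) Z < ⊤ := hZ
  lift conjugate (shortfall P l) Z to ℝ using ⟨h1.ne, (EReal.bot_lt_zero.trans_le h0).ne'⟩ with r
  exact ⟨r, by exact_mod_cast h0, rfl⟩

/-- Cash invariance: the constant `c` is acceptable at level `c`, so c(E[Z] - 1) stays bounded over
all `c`. -/
lemma integral_le_one_of_mem_domConj [IsProbabilityMeasure P] {Z : Lp ℝ 1 P}
    (hZ : Z ∈ domConj (shortfall P l)) : ∫ ω, Z ω ∂P ≤ 1 := by
  obtain ⟨r, hr, hZr⟩ := exists_conjugate_eq_coe hZ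
  by_contra! hlt
  have key : ∀ c : ℝ, c * ∫ ω, Z ω ∂P - c ≤ r := by
    intro c
    have h := le_conjugate (l := l) (P := P) (f := fun _ => c) (C := |c|) (x := c)
      aestronglyMeasurable_const (by simp) (by simp) Z
    rw [hZr, integral_const_mul] at h
    exact_mod_cast h
  have h := key ((r + 1) / (∫ ω, Z ω ∂P - 1))
  have h2 : (r + 1) / (∫ ω, Z ω ∂P - 1) * (∫ ω, Z ω ∂P - 1) = r + 1 :=
    div_mul_cancel₀ _ (sub_pos.2 hlt).ne'
  linarith

/-- The position -c on {Z < 0} is acceptable at level 0 by monotonicity; letting `c` grow forces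
E[Z⁻] = 0. -/
lemma nonneg_of_mem_domConj [IsProbabilityMeasure P] (hmono : Monotone l) {Z : Lp ℝ 1 P}
    (hZ : Z ∈ domConj (shortfall P l)) : 0 ≤ᵐ[P] Z := by
  obtain ⟨r, hr, hZr⟩ := exists_conjugate_eq_coe hZ
  have hint : Integrable Z P := L1.integrable_coeFn Z
  have hmeas : Measurable (Z : Ω → ℝ) := (Lp.stronglyMeasurable Z).measurable
  have hS : MeasurableSet {ω | Z ω < 0} := measurableSet_lt hmeas measurable_const
  have key : ∀ c : ℝ, 0 ≤ c → c * ∫ ω, max (-Z ω) 0 ∂P ≤ r := by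
    intro c hc
    have h := le_conjugate (l := l) (P := P) (f := {ω | Z ω < 0}.indicator fun _ => -c)
      (C := c) (x := 0) (measurable_const.indicator hS).aestronglyMeasurable
      (ae_of_all _ fun ω => by
        by_cases hω : Z ω < 0 <;> simp [Set.indicator, hω, abs_of_nonneg hc, hc])
      (by
        have : ∫ ω, l (({ω | Z ω < 0}.indicator fun _ => -c) ω - 0) ∂P ≤ ∫ _, l 0 ∂P := by
          refine integral_mono (integrable_comp_sub_of_monotone hmono (C := c)
            (measurable_const.indicator hS).aemeasurable (ae_of_all _ fun ω => by
              by_cases hω : Z ω < 0 <;> simp [Set.indicator, hω, abs_of_nonneg hc, hc]) 0)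
            (integrable_const _) fun ω => hmono ?_
          by_cases hω : Z ω < 0 <;> simp [Set.indicator, hω, hc]
        simpa using this) Z
    have h2 : ∫ ω, ({ω | Z ω < 0}.indicator fun _ => -c) ω * Z ω ∂P
        = c * ∫ ω, max (-Z ω) 0 ∂P := by
      rw [← integral_const_mul]
      refine integral_congr_ae (ae_of_all _ fun ω => ?_)
      by_cases hω : Z ω < 0
      · simp [Set.indicator, hω, max_eq_left (neg_pos.2 hω).le]
      · simp [Set.indicator, hω, not_lt.1 hω]
    rw [hZr, h2, sub_zero] at h
    exact_mod_cast h
  have h0 : ∫ ω, max (-Z ω) 0 ∂P = 0 := by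
    by_contra hne
    have hpos : 0 < ∫ ω, max (-Z ω) 0 ∂P :=
      lt_of_le_of_ne (integral_nonneg fun ω => le_max_right _ _) (Ne.symm hne)
    have h := key ((r + 1) / ∫ ω, max (-Z ω) 0 ∂P) (by positivity)
    rw [div_mul_cancel₀ _ hne] at h
    linarith
  have h1 := (integral_eq_zero_iff_of_nonneg (fun ω => le_max_right _ _) hint.neg.pos_part).1 h0
  filter_upwards [h1] with ω hω
  have : max (-Z ω) 0 = 0 := hω
  have := le_max_left (-Z ω) 0
  show 0 ≤ Z ω
  linarith

variable [IsProbabilityMeasure P]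

/-! ### Two-sided control of φ̂ -/

/-- If `E[l(Y - ε)] ≤ l(0)` then `φ̂(Y) ≤ ε`, also for unbounded `Y ≥ 0`. -/
lemma phiHat_le (hmono : Monotone l) {Y : Ω → ℝ} (hY : Measurable Y) (hY0 : ∀ ω, 0 ≤ Y ω)
    {ε : ℝ} (hint : Integrable (fun ω => l (Y ω - ε)) P) (hle : ∫ ω, l (Y ω - ε) ∂P ≤ l 0) :
    phiHat (shortfall P l) Y ≤ ε := by
  refine iSup₂_le fun Z hZ => ?_
  obtain ⟨r, hr, hZr⟩ := exists_conjugate_eq_coe hZ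
  have hZ0 := nonneg_of_mem_domConj hmono hZ
  have key : ∀ n : ℕ, ∫ ω, min (Y ω) (n : ℝ) * Z ω ∂P ≤ ε + r := by
    intro n
    have hb : ∀ᵐ ω ∂P, |min (Y ω) (n : ℝ)| ≤ n :=
      ae_of_all _ fun ω => abs_min_natCast_le (hY0 ω) n
    have hm : Measurable fun ω => min (Y ω) (n : ℝ) := hY.min measurable_const
    have h := le_conjugate (l := l) (x := ε) hm.aestronglyMeasurable hb
      ((integral_mono (integrable_comp_sub_of_monotone hmono hm.aemeasurable hb ε) hint
        fun ω => hmono (sub_le_sub_right (min_le_left _ _) ε)).trans hle) Z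
    rw [hZr, EReal.coe_le_coe_iff] at h
    linarith
  -- The truncation at 0 vanishes, so `key 0` gives the sign; without it `ENNReal.ofReal` would lose
  -- information.
  have hεr : 0 ≤ ε + r := by
    refine le_trans (integral_nonneg_of_ae ?_) (key 0)
    filter_upwards [hZ0] with ω hω
    exact mul_nonneg (le_min (hY0 ω) (by simp)) hω
  have h1 : ∫⁻ ω, ENNReal.ofReal (Y ω * Z ω) ∂P ≤ ENNReal.ofReal (ε + r) := by
    refine lintegral_ofReal_le_of_tendsto (fun n => integrable_min_mul hY hY0 n Z) (fun n => ?_)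
      (ae_of_all _ fun ω => (tendsto_min_natCast (Y ω)).mul_const (Z ω)) key
    filter_upwards [hZ0] with ω hω
    exact mul_nonneg (le_min (hY0 ω) n.cast_nonneg) hω
  rw [hZr, extExp_of_nonneg (by
    filter_upwards [hZ0] with ω hω
    exact mul_nonneg (hY0 ω) hω)]
  refine EReal.sub_le_of_le_add ?_
  refine (EReal.coe_ennreal_le_coe_ennreal_iff.2 h1).trans ?_
  rw [EReal.coe_ennreal_ofReal, max_eq_left hεr, EReal.coe_add]

/-- An optimal dual variable for a bounded position `Y ≥ 0`: the normalised subgradient of `l`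
along `Y - φ(Y)`. -/
lemma exists_dual_optimizer (hmono : Monotone l) (hconv : ConvexOn ℝ Set.univ l)
    (hinf : ∃ x, l x < l 0) {Y : Ω → ℝ} (hY : Measurable Y) {C : ℝ} (hC : 0 ≤ C)
    (hY0 : ∀ ω, 0 ≤ Y ω) (hYC : ∀ ω, Y ω ≤ C) :
    ∃ x : ℝ, 0 ≤ x ∧ ∫ ω, l (Y ω - x) ∂P = l 0 ∧ ∃ Z : Lp ℝ 1 P, 0 ≤ᵐ[P] Z ∧
      conjugate (shortfall P l) Z ≤ ((∫ ω, Y ω * Z ω ∂P - x : ℝ) : EReal) := by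
  have hYb : ∀ᵐ ω ∂P, |Y ω| ≤ C := ae_of_all _ fun ω => by
    rw [abs_of_nonneg (hY0 ω)]; exact hYC ω
  have hl (x : ℝ) : Integrable (fun ω => l (Y ω - x)) P :=
    integrable_comp_sub_of_monotone hmono hY.aemeasurable hYb x
  have hcont : ContinuousOn (fun x => ∫ ω, l (Y ω - x) ∂P) (Set.Icc 0 C) := by
    refine continuousOn_of_dominated (bound := fun _ => max |l (-C)| |l C|)
      (fun x _ => (hl x).aestronglyMeasurable) (fun x hx => ae_of_all _ fun ω => ?_)
      (integrable_const _) (ae_of_all _ fun ω => ?_)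
    · exact abs_le_max_abs_abs (hmono (by linarith [hx.2, hY0 ω]))
        (hmono (by linarith [hx.1, hYC ω]))
    · exact ((continuous_of_convexOn_univ hconv).comp
        (continuous_const.sub continuous_id)).continuousOn
  -- Since 0 ≤ Y ≤ C, the expected loss is at least l(0) at level 0 and at most l(0) at level `C`.
  obtain ⟨x, hx, hxl⟩ := intermediate_value_Icc' hC hcont (show l 0 ∈ Set.Icc _ _ from by
    constructor
    · have := integral_mono (hl C) (integrable_const (l 0)) fun ω =>
        hmono (by linarith [hYC ω] : Y ω - C ≤ 0)
      simpa using this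
    · have := integral_mono (integrable_const (l 0)) (hl 0) fun ω =>
        hmono (by linarith [hY0 ω] : 0 ≤ Y ω - 0)
      simpa using this)
  replace hxl : ∫ ω, l (Y ω - x) ∂P = l 0 := hxl
  refine ⟨x, hx.1, hxl, ?_⟩
  obtain ⟨g, hg, hsub⟩ := exists_monotone_subgradient hconv
  have hg0 : ∀ y, 0 ≤ g y := fun y => by
    have h1 := hsub y (y - 1)
    have h2 := hmono (by linarith : y - 1 ≤ y)
    linarith
  have hG : Integrable (fun ω => g (Y ω - x)) P :=
    integrable_comp_sub_of_monotone hg hY.aemeasurable hYb x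
  set m := ∫ ω, g (Y ω - x) ∂P with hm
  -- If the mean slope were 0, Y - x would a.s. lie among the minimisers of `l`, contradicting E[l(Y
  -- - x)] = l(0) > inf l.
  have hmpos : 0 < m := by
    refine lt_of_le_of_ne (integral_nonneg fun ω => hg0 _) fun h0 => ?_
    have h1 := (integral_eq_zero_iff_of_nonneg (fun ω => hg0 _) hG).1 h0.symm
    obtain ⟨x₀, hx₀⟩ := hinf
    have h2 : ∫ ω, l (Y ω - x) ∂P ≤ ∫ _, l x₀ ∂P := by
      refine integral_mono_ae (hl x) (integrable_const _) ?_
      filter_upwards [h1] with ω hω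
      have h3 := hsub (Y ω - x) x₀
      rw [show g (Y ω - x) = 0 from hω] at h3
      linarith
    rw [hxl] at h2
    simp at h2
    linarith
  have hZ : MemLp (fun ω => g (Y ω - x) / m) 1 P := memLp_one_iff_integrable.2 (hG.div_const m)
  have hZc := hZ.coeFn_toLp
  have hmul (f : Ω → ℝ) : ∫ ω, f ω * hZ.toLp _ ω ∂P = (∫ ω, f ω * g (Y ω - x) ∂P) / m := by
    rw [← integral_div]
    refine integral_congr_ae ?_
    filter_upwards [hZc] with ω hω
    rw [hω, mul_div_assoc]
  refine ⟨hZ.toLp _, ?_, conjugate_le fun X x' hx' => ?_⟩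
  · filter_upwards [hZc] with ω hω
    rw [hω]
    exact div_nonneg (hg0 _) hmpos.le
  · obtain ⟨B, hB⟩ := ae_abs_le_of_memLp_top X
    have hXm : AEStronglyMeasurable X P := Lp.aestronglyMeasurable X
    have hXg : Integrable (fun ω => X ω * g (Y ω - x)) P := hG.bdd_mul hXm hB
    have hYg : Integrable (fun ω => Y ω * g (Y ω - x)) P :=
      hG.bdd_mul hY.aestronglyMeasurable hYb
    -- Integrated subgradient inequality from Y - x to X - x'. Both expected losses are compared
    -- with l(0), and division by `m` gives optimality.
    have hle : ∫ ω, (l (Y ω - x) + (X ω * g (Y ω - x) - Y ω * g (Y ω - x)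
        + (x - x') * g (Y ω - x))) ∂P ≤ ∫ ω, l (X ω - x') ∂P := by
      refine integral_mono ((hl x).add ((hXg.sub hYg).add (hG.const_mul _)))
        (integrable_comp_sub_of_monotone hmono hXm.aemeasurable hB x') fun ω => ?_
      have := hsub (Y ω - x) (X ω - x')
      show l (Y ω - x) + _ ≤ l (X ω - x')
      linarith
    have hsum : ∫ ω, (l (Y ω - x) + (X ω * g (Y ω - x) - Y ω * g (Y ω - x)
        + (x - x') * g (Y ω - x))) ∂P
        = l 0 + (∫ ω, X ω * g (Y ω - x) ∂P - ∫ ω, Y ω * g (Y ω - x) ∂P + (x - x') * m) := by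
      have hD : Integrable (fun ω => X ω * g (Y ω - x) - Y ω * g (Y ω - x)) P := hXg.sub hYg
      have hE : Integrable (fun ω => (x - x') * g (Y ω - x)) P := hG.const_mul _
      have hDE : Integrable (fun ω => X ω * g (Y ω - x) - Y ω * g (Y ω - x)
        + (x - x') * g (Y ω - x)) P := hD.add hE
      rw [integral_add (hl x) hDE, integral_add hD hE, integral_sub hXg hYg, integral_const_mul,
        hxl]
    rw [hsum] at hle
    have h4 : (∫ ω, X ω * g (Y ω - x) ∂P - ∫ ω, Y ω * g (Y ω - x) ∂P) / m ≤ x' - x := by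
      rw [div_le_iff₀ hmpos]
      linarith
    rw [sub_div] at h4
    rw [hmul, hmul]
    linarith

lemma exists_le_phiHat (hmono : Monotone l) (hconv : ConvexOn ℝ Set.univ l)
    (hinf : ∃ x, l x < l 0) {Y : Ω → ℝ} (hY : Measurable Y) (hY0 : ∀ ω, 0 ≤ Y ω) (n : ℕ) :
    ∃ x : ℝ, 0 ≤ x ∧ ∫ ω, l (min (Y ω) (n : ℝ) - x) ∂P = l 0 ∧
      (x : EReal) ≤ phiHat (shortfall P l) Y := by
  obtain ⟨x, hx0, hx, Z, hZ0, hZ⟩ := exists_dual_optimizer (P := P) hmono hconv hinf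
    (Y := fun ω => min (Y ω) (n : ℝ)) (hY.min measurable_const) (C := n) n.cast_nonneg
    (fun ω => le_min (hY0 ω) n.cast_nonneg) fun ω => min_le_right _ _
  refine ⟨x, hx0, hx, ?_⟩
  refine le_iSup₂_of_le Z (hZ.trans_lt (EReal.coe_lt_top _)) ?_
  have h1 : ((∫ ω, min (Y ω) (n : ℝ) * Z ω ∂P : ℝ) : EReal) ≤ extExp P fun ω => Y ω * Z ω := by
    have hnn : 0 ≤ᵐ[P] fun ω => min (Y ω) (n : ℝ) * Z ω := by
      filter_upwards [hZ0] with ω hω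
      exact mul_nonneg (le_min (hY0 ω) n.cast_nonneg) hω
    rw [extExp_of_nonneg (by
      filter_upwards [hZ0] with ω hω
      exact mul_nonneg (hY0 ω) hω), ← max_eq_left (integral_nonneg_of_ae hnn),
      ← EReal.coe_ennreal_ofReal,
      ofReal_integral_eq_lintegral_ofReal (integrable_min_mul hY hY0 n Z) hnn,
      EReal.coe_ennreal_le_coe_ennreal_iff]
    refine lintegral_mono_ae ?_
    filter_upwards [hZ0] with ω hω
    exact ENNReal.ofReal_le_ofReal (mul_le_mul_of_nonneg_right (min_le_left _ _) hω)
  have h2 := EReal.sub_le_sub h1 hZ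
  rwa [← EReal.coe_sub, sub_sub_cancel] at h2

lemma phiHat_nonneg (hmono : Monotone l) (hconv : ConvexOn ℝ Set.univ l)
    (hinf : ∃ x, l x < l 0) {Y : Ω → ℝ} (hY : Measurable Y) (hY0 : ∀ ω, 0 ≤ Y ω) :
    0 ≤ phiHat (shortfall P l) Y := by
  obtain ⟨x, hx0, -, hx⟩ := exists_le_phiHat (P := P) hmono hconv hinf hY hY0 0
  exact le_trans (by exact_mod_cast hx0) hx

/-- Any real `c` above φ̂(Y) dominates the levels of all truncations, so their expected losses at
`c` are at most l(0). Subtracting l(-c) makes the integrands nonnegative for Fatou. -/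
lemma exists_lintegral_lt_top_of_phiHat_lt_top (hmono : Monotone l)
    (hconv : ConvexOn ℝ Set.univ l) (hinf : ∃ x, l x < l 0) {Y : Ω → ℝ} (hY : Measurable Y)
    (hY0 : ∀ ω, 0 ≤ Y ω) (h : phiHat (shortfall P l) Y < ⊤) :
    ∃ c : ℝ, ∫⁻ ω, ENNReal.ofReal (l (Y ω - c) - l (-c)) ∂P < ⊤ := by
  obtain ⟨c, hc, -⟩ := EReal.lt_iff_exists_real_btwn.1 h
  refine ⟨c, lt_of_le_of_lt (lintegral_ofReal_le_of_tendsto (c := l 0 - l (-c))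
    (F := fun n ω => l (min (Y ω) (n : ℝ) - c) - l (-c)) (fun n => ?_)
    (fun n => ae_of_all _ fun ω => ?_) (ae_of_all _ fun ω => ?_) fun n => ?_)
    ENNReal.ofReal_lt_top⟩
  · exact (integrable_comp_sub_of_monotone hmono (hY.min measurable_const).aemeasurable
      (ae_of_all _ fun ω => abs_min_natCast_le (hY0 ω) n) c).sub (integrable_const _)
  · exact sub_nonneg.2 (hmono (by
      have : 0 ≤ min (Y ω) (n : ℝ) := le_min (hY0 ω) n.cast_nonneg
      linarith))
  · exact (((continuous_of_convexOn_univ hconv).tendsto _).comp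
      ((tendsto_min_natCast (Y ω)).sub_const c)).sub_const _
  · have hi (x : ℝ) : Integrable (fun ω => l (min (Y ω) (n : ℝ) - x)) P :=
      integrable_comp_sub_of_monotone hmono (hY.min measurable_const).aemeasurable
        (ae_of_all _ fun ω => abs_min_natCast_le (hY0 ω) n) x
    obtain ⟨x, -, hx, hxc⟩ := exists_le_phiHat (P := P) hmono hconv hinf hY hY0 n
    have hxc' : x ≤ c := by exact_mod_cast hxc.trans hc.le
    rw [integral_sub (hi c) (integrable_const _), ← hx]
    have := integral_mono (hi c) (hi x) fun ω => hmono (sub_le_sub_left hxc' _)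
    simpa using this

/-! ### The cycle of inclusions -/

lemma heartU_subset_heart (hmono : Monotone l) :
    heartU (shortfall P l) ⊆ heart (shortfall P l) := by
  intro X hX α hα
  obtain ⟨N, hN⟩ := ((hX α hα).eventually (gt_mem_nhds (zero_lt_one (α := EReal)))).exists
  have hXm : Measurable (X : Ω → ℝ) := X.measurable
  set Y := {ω | (N : ℝ) < |X ω|}.indicator fun ω => α * |X ω| with hYdef
  have hYm : Measurable Y := (measurable_const.mul hXm.abs).indicator
    (measurableSet_lt measurable_const hXm.abs)
  have hY0 : ∀ ω, 0 ≤ Y ω := fun ω => Set.indicator_nonneg (fun ω _ => by positivity) ω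
  have hXY : ∀ ω, α * |X ω| ≤ α * N + Y ω := fun ω => by
    by_cases h : (N : ℝ) < |X ω|
    · have : Y ω = α * |X ω| := Set.indicator_of_mem (s := {ω | (N : ℝ) < |X ω|}) h _
      rw [this]
      linarith [mul_nonneg hα.le (Nat.cast_nonneg (α := ℝ) N)]
    · linarith [hY0 ω, mul_le_mul_of_nonneg_left (not_lt.1 h) hα.le]
  refine lt_of_le_of_lt (iSup₂_le fun Z hZ => ?_) (EReal.coe_lt_top (α * N + 1))
  obtain ⟨r, hr, hZr⟩ := exists_conjugate_eq_coe hZ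
  have hZ0 := nonneg_of_mem_domConj hmono hZ
  have hZ1 := integral_le_one_of_mem_domConj hZ
  have h1 : ∫⁻ ω, ENNReal.ofReal (Y ω * Z ω) ∂P ≤ ENNReal.ofReal (1 + r) := by
    have h2 : extExp P (fun ω => Y ω * Z ω) - conjugate (shortfall P l) Z ≤ 1 :=
      (le_iSup₂_of_le (f := fun Z (_ : Z ∈ domConj (shortfall P l)) =>
        extExp P (fun ω => Y ω * Z ω) - conjugate (shortfall P l) Z) Z hZ le_rfl).trans hN.le
    rw [hZr, extExp_of_nonneg (by
      filter_upwards [hZ0] with ω hω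
      exact mul_nonneg (hY0 ω) hω), EReal.sub_le_iff_le_add (by simp) (by simp)] at h2
    rw [← EReal.coe_ennreal_le_coe_ennreal_iff, EReal.coe_ennreal_ofReal,
      max_eq_left (by linarith), EReal.coe_add]
    exact h2
  have hαN : 0 ≤ α * N := by positivity
  have h3 : ∫⁻ ω, ENNReal.ofReal (α * |X ω| * Z ω) ∂P ≤ ENNReal.ofReal (α * N + (1 + r)) := by
    calc ∫⁻ ω, ENNReal.ofReal (α * |X ω| * Z ω) ∂P
        ≤ ∫⁻ ω, (ENNReal.ofReal (α * N * Z ω) + ENNReal.ofReal (Y ω * Z ω)) ∂P := by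
          refine lintegral_mono_ae ?_
          filter_upwards [hZ0] with ω hω
          rw [← ENNReal.ofReal_add (mul_nonneg hαN hω) (mul_nonneg (hY0 ω) hω), ← add_mul]
          exact ENNReal.ofReal_le_ofReal (mul_le_mul_of_nonneg_right (hXY ω) hω)
      _ = ENNReal.ofReal (∫ ω, α * N * Z ω ∂P) + ∫⁻ ω, ENNReal.ofReal (Y ω * Z ω) ∂P := by
          have hi : Integrable (fun ω => α * N * Z ω) P :=
            (L1.integrable_coeFn Z).const_mul _
          rw [lintegral_add_left' hi.aemeasurable.ennreal_ofReal,
            ofReal_integral_eq_lintegral_ofReal hi (by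
              filter_upwards [hZ0] with ω hω
              exact mul_nonneg hαN hω)]
      _ ≤ ENNReal.ofReal (α * N) + ENNReal.ofReal (1 + r) := by
          refine add_le_add (ENNReal.ofReal_le_ofReal ?_) h1
          rw [integral_const_mul]
          exact mul_le_of_le_one_right hαN hZ1
      _ = ENNReal.ofReal (α * N + (1 + r)) := (ENNReal.ofReal_add hαN (by linarith)).symm
  rw [hZr, extExp_of_nonneg (by
    filter_upwards [hZ0] with ω hω
    exact mul_nonneg (by positivity) hω)]
  refine EReal.sub_le_of_le_add ((EReal.coe_ennreal_le_coe_ennreal_iff.2 h3).trans ?_)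
  rw [EReal.coe_ennreal_ofReal, max_eq_left (by linarith), ← EReal.coe_add, add_assoc]

lemma heart_subset_orliczHeart (hmono : Monotone l) (hconv : ConvexOn ℝ Set.univ l)
    (hinf : ∃ x, l x < l 0) : heart (shortfall P l) ⊆ orliczHeart P (youngOf l) := by
  intro X hX α hα
  have hXm : Measurable (X : Ω → ℝ) := X.measurable
  have h2 : ∀ ω, 0 ≤ 2 * α * |X ω| := fun ω => by positivity
  obtain ⟨c, hc⟩ := exists_lintegral_lt_top_of_phiHat_lt_top hmono hconv hinf
    (measurable_const.mul hXm.abs) h2 (hX (2 * α) (by positivity))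
  set K := 1 / 2 * l (-c) + 1 / 2 * l c - l 0 with hK
  calc ∫⁻ ω, ENNReal.ofReal (youngOf l (α * |X ω|)) ∂P
      ≤ ∫⁻ ω, (ENNReal.ofReal (l (2 * α * |X ω| - c) - l (-c)) + ENNReal.ofReal K) ∂P := by
        refine lintegral_mono fun ω => ?_
        refine le_trans (ENNReal.ofReal_le_ofReal ?_) ENNReal.ofReal_add_le
        -- The factor 2 pays for the shift: α|X| is the midpoint of 2α|X| - c and `c`.
        have h3 := hconv.2 (Set.mem_univ (2 * α * |X ω| - c)) (Set.mem_univ c)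
          (show (0 : ℝ) ≤ 1 / 2 by norm_num) (show (0 : ℝ) ≤ 1 / 2 by norm_num) (by norm_num)
        have h4 : 1 / 2 * (2 * α * |X ω| - c) + 1 / 2 * c = α * |X ω| := by ring
        simp only [smul_eq_mul, h4] at h3
        have h5 : l (-c) ≤ l (2 * α * |X ω| - c) := hmono (by linarith [h2 ω])
        rw [youngOf, abs_of_nonneg (by positivity), hK]
        linarith
    _ = ∫⁻ ω, ENNReal.ofReal (l (2 * α * |X ω| - c) - l (-c)) ∂P + ENNReal.ofReal K := by
        rw [lintegral_add_right _ measurable_const]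
        simp
    _ < ⊤ := ENNReal.add_lt_top.2 ⟨hc, ENNReal.ofReal_lt_top⟩

lemma orliczHeart_subset_heartU (hmono : Monotone l) (hconv : ConvexOn ℝ Set.univ l)
    (hinf : ∃ x, l x < l 0) : orliczHeart P (youngOf l) ⊆ heartU (shortfall P l) := by
  intro X hX α hα
  have hXm : Measurable (X : Ω → ℝ) := X.measurable
  set Y : ℕ → Ω → ℝ := fun N => {ω | (N : ℝ) < |X ω|}.indicator fun ω => α * |X ω| with hYdef
  have hYm (N : ℕ) : Measurable (Y N) := (measurable_const.mul hXm.abs).indicator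
    (measurableSet_lt measurable_const hXm.abs)
  have hY0 (N : ℕ) (ω : Ω) : 0 ≤ Y N ω := Set.indicator_nonneg (fun ω _ => by positivity) ω
  have hYle (N : ℕ) (ω : Ω) : Y N ω ≤ α * |X ω| :=
    Set.indicator_le_self' (fun _ _ => by positivity) ω
  have hlX : Integrable (fun ω => l (α * |X ω|)) P := by
    have h1 : Integrable (fun ω => l (α * |X ω|) - l 0) P := by
      refine ⟨((hmono.measurable.comp (measurable_const.mul hXm.abs)).sub_const
        _).aestronglyMeasurable, ?_⟩
      rw [hasFiniteIntegral_iff_ofReal (ae_of_all _ fun ω => sub_nonneg.2 (hmono (by positivity)))]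
      have h2 := hX α hα
      simp only [youngOf, abs_mul, abs_abs, abs_of_pos hα] at h2
      exact h2
    exact (h1.add (integrable_const (l 0))).congr (ae_of_all _ fun ω => sub_add_cancel _ _)
  have hmeas (N : ℕ) (ε : ℝ) : Measurable fun ω => l (Y N ω - ε) :=
    hmono.measurable.comp ((hYm N).sub_const ε)
  have hbound (ε : ℝ) (hε : 0 < ε) (N : ℕ) (ω : Ω) :
      ‖l (Y N ω - ε)‖ ≤ |l (-ε)| + |l (α * |X ω|)| := by
    refine (abs_le_max_abs_abs (hmono (by linarith [hY0 N ω] : -ε ≤ Y N ω - ε))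
      (hmono (by linarith [hYle N ω] : Y N ω - ε ≤ α * |X ω|))).trans ?_
    exact max_le_add_of_nonneg (abs_nonneg _) (abs_nonneg _)
  have hbi (ε : ℝ) : Integrable (fun ω => |l (-ε)| + |l (α * |X ω|)|) P :=
    (integrable_const _).add hlX.abs
  refine tendsto_order.2 ⟨fun b hb => Eventually.of_forall fun N =>
    hb.trans_le (phiHat_nonneg hmono hconv hinf (hYm N) (hY0 N)), fun b hb => ?_⟩
  obtain ⟨ε, hε0, hεb⟩ := EReal.lt_iff_exists_real_btwn.1 hb
  have hε : 0 < ε := by exact_mod_cast hε0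
  have hlim : Tendsto (fun N => ∫ ω, l (Y N ω - ε) ∂P) atTop (𝓝 (∫ _, l (-ε) ∂P)) := by
    refine tendsto_integral_of_dominated_convergence _
      (fun N => (hmeas N ε).aestronglyMeasurable) (hbi ε)
      (fun N => ae_of_all _ (hbound ε hε N)) (ae_of_all _ fun ω => ?_)
    refine tendsto_const_nhds.congr' ?_
    filter_upwards [eventually_ge_atTop ⌈|X ω|⌉₊] with N hN
    have hωN : ¬ (N : ℝ) < |X ω| := not_lt.2 ((Nat.le_ceil _).trans (Nat.cast_le.2 hN))
    have h0 : Y N ω = 0 := Set.indicator_of_notMem (s := {ω | (N : ℝ) < |X ω|})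
      hωN _
    rw [h0, zero_sub]
  -- Strictness comes from l(0) > inf l and leaves room for the acceptance condition to hold at
  -- finite `N`.
  have hlt : ∫ _, l (-ε) ∂P < l 0 := by
    simpa using lt_apply_zero_of_neg hmono hconv hinf (neg_lt_zero.2 hε)
  filter_upwards [hlim.eventually (gt_mem_nhds hlt)] with N hN
  exact (phiHat_le hmono (hYm N) (hY0 N) ((hbi ε).mono' (hmeas N ε).aestronglyMeasurable
    (ae_of_all _ (hbound ε hε N))) hN.le).trans_lt hεb

end ShortfallRisk

theorem mainTheorem8 {Ω : Type*} [MeasurableSpace Ω] (P : Measure Ω) [IsProbabilityMeasure P]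
    (l : ℝ → ℝ) (hmono : Monotone l) (hconv : ConvexOn ℝ Set.univ l) (hinf : ∃ x, l x < l 0) :
    ShortfallRisk.IsYoungFunction (ShortfallRisk.youngOf l) ∧
    ShortfallRisk.heartU (ShortfallRisk.shortfall P l) =
      ShortfallRisk.heart (ShortfallRisk.shortfall P l) ∧
    ShortfallRisk.heart (ShortfallRisk.shortfall P l) =
      ShortfallRisk.orliczHeart P (ShortfallRisk.youngOf l) := by
  have h1 := ShortfallRisk.heartU_subset_heart (P := P) hmono
  have h2 := ShortfallRisk.heart_subset_orliczHeart (P := P) hmono hconv hinf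
  have h3 := ShortfallRisk.orliczHeart_subset_heartU (P := P) hmono hconv hinf
  exact ⟨ShortfallRisk.isYoungFunction_youngOf hmono hconv hinf,
    h1.antisymm (h2.trans h3), h2.antisymm (h3.trans h1)⟩
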